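/- Let $n\ge 1$ and let $\mathbb D^n=\{z\in\mathbb C^n:|z_i|<1,\ 1\le i\le n\}$ be the unit polydisc, with distinguished boundary $\mathbb T^n$. Let $H^2(\mathbb D^n)$ be the Hardy space of all power series $f(z)=\sum_{m\in\mathbb N^n}a_m z^m$ on $\mathbb D^n$ with $\|f\|^2=\sum_m|a_m|^2<\infty$, i.e. the reproducing kernel Hilbert space on $\mathbb D^n$ with the Szegő kernel $\prod_{i=1}^n(1-z_i\bar w_i)^{-1}$. Let $\theta\in H^\infty(\mathbb D^n)$ (a bounded holomorphic function on $\mathbb D^n$) be a non-constant inner function, that is, for almost every $\zeta\in\mathbb T^n$ the radial limit $\theta(\zeta)=\lim_{r\to1^-}\theta(r\zeta)$ exists and $|\theta(\zeta)|=1$. Then multiplication by $\theta$ defines a bounded operator $M_\theta$ on $H^2(\mathbb D^n)$, $M_\theta f=\theta f$, and $M_\theta$ is a pure isometry: $\|M_\theta f\|=\|f\|$ for all $f\in H^2(\mathbb D^n)$, and $\|M_\theta^{*m}f\|\to0$ as $m\to\infty$ for every $f\in H^2(\mathbb D^n)$. -/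

import Mathlib

open Filter Topology

noncomputable section

namespace PolydiscHardy

/-- The open unit polydisc `𝔻ⁿ` in `ℂⁿ`. -/
def polydisc (n : ℕ) : Set (Fin n → ℂ) := {z | ∀ i, ‖z i‖ < 1}

/-- The monomial `z ^ m = ∏ i, (z i) ^ (m i)`. -/
def monomial {n : ℕ} (m : Fin n → ℕ) (z : Fin n → ℂ) : ℂ := ∏ i, z i ^ m i

/-- The multivariable geometric series, for real or complex variables. -/
theorem hasSum_geometric_multi {𝕜 : Type*} [RCLike 𝕜] {n : ℕ} (x : Fin n → 𝕜)
    (hx : ∀ i, ‖x i‖ < 1) :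
    (Summable fun m : Fin n → ℕ => ‖∏ i, x i ^ m i‖) ∧
      HasSum (fun m : Fin n → ℕ => ∏ i, x i ^ m i) (∏ i, (1 - x i)⁻¹) := by
  induction n with
  | zero =>
    refine ⟨(hasSum_fintype _).summable, ?_⟩
    simp
  | succ n ih =>
    obtain ⟨hs, hh⟩ := ih (fun i => x (Fin.succ i)) (fun i => hx _)
    have h0s : Summable fun k : ℕ => ‖x 0 ^ k‖ := by
      simpa only [norm_pow] using summable_geometric_of_lt_one (norm_nonneg _) (hx 0)
    have h0 : HasSum (fun k : ℕ => x 0 ^ k) (1 - x 0)⁻¹ := hasSum_geometric_of_norm_lt_one (hx 0)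
    have hS := Summable.mul_norm (f := fun k : ℕ => x 0 ^ k)
      (g := fun m : Fin n → ℕ => ∏ i, x (Fin.succ i) ^ m i) h0s hs
    have hprod := h0.mul hh (summable_mul_of_summable_norm (f := fun k : ℕ => x 0 ^ k)
      (g := fun m : Fin n → ℕ => ∏ i, x (Fin.succ i) ^ m i) h0s hs)
    have key : ∀ p : ℕ × (Fin n → ℕ), x 0 ^ p.1 * ∏ i, x (Fin.succ i) ^ p.2 i =
        ∏ i, x i ^ (Fin.consEquiv (fun _ => ℕ) p) i := by
      intro p
      rw [Fin.prod_univ_succ]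
      simp [Fin.consEquiv]
    simp only [key] at hS hprod
    rw [Fin.prod_univ_succ]
    exact ⟨(Fin.consEquiv (fun _ : Fin (n + 1) => ℕ)).summable_iff.1 hS,
      (Fin.consEquiv (fun _ : Fin (n + 1) => ℕ)).hasSum_iff.1 hprod⟩

/-- The Hardy space `H²(𝔻ⁿ)`: the power series `∑ a_m z ^ m` in `n` variables with
square-summable coefficients, with the `ℓ²` inner product of the coefficients. An element is stored
as its family of coefficients; the `RKHS` instance below identifies it with the function on the
polydisc that it represents. -/
def HardySpace (n : ℕ) : Type := lp (fun _ : Fin n → ℕ => ℂ) 2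

namespace HardySpace

variable {n : ℕ}

instance : NormedAddCommGroup (HardySpace n) :=
  inferInstanceAs (NormedAddCommGroup (lp (fun _ : Fin n → ℕ => ℂ) 2))

instance : InnerProductSpace ℂ (HardySpace n) :=
  inferInstanceAs (InnerProductSpace ℂ (lp (fun _ : Fin n → ℕ => ℂ) 2))

instance : CompleteSpace (HardySpace n) :=
  inferInstanceAs (CompleteSpace (lp (fun _ : Fin n → ℕ => ℂ) 2))

/-- The coefficient `a_m` of `f = ∑ a_m z ^ m`. -/
def coeff (f : HardySpace n) (m : Fin n → ℕ) : ℂ :=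
  (show lp (fun _ : Fin n → ℕ => ℂ) 2 from f) m

theorem inner_eq (f g : HardySpace n) : inner ℂ f g = ∑' m, inner ℂ (f.coeff m) (g.coeff m) :=
  lp.inner_eq_tsum (𝕜 := ℂ) (G := fun _ : Fin n → ℕ => ℂ) f g

theorem summable_norm_sq_monomial (z : polydisc n) :
    Summable fun m : Fin n → ℕ => ‖monomial m (z : Fin n → ℂ)‖ ^ 2 := by
  have h := (hasSum_geometric_multi (fun i => ‖(z : Fin n → ℂ) i‖ ^ 2) (fun i => by
    have := z.2 i
    have h0 := norm_nonneg ((z : Fin n → ℂ) i)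
    rw [Real.norm_of_nonneg (by positivity)]
    nlinarith)).2.summable
  refine h.congr fun m => ?_
  simp only [monomial, norm_prod, norm_pow]
  rw [← Finset.prod_pow]
  exact Finset.prod_congr rfl fun i _ => by rw [← pow_mul, ← pow_mul, mul_comm]

/-- The power series `∑ conj (z ^ m) w ^ m`, i.e. the Szegő kernel function at `z`. -/
def szegoVec (z : polydisc n) : HardySpace n :=
  show lp (fun _ : Fin n → ℕ => ℂ) 2 from
    ⟨fun m => star (monomial m (z : Fin n → ℂ)), by
      refine memℓp_gen ?_
      simpa using summable_norm_sq_monomial z⟩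

theorem hasSum_eval (f : HardySpace n) (z : polydisc n) :
    HasSum (fun m => f.coeff m * monomial m (z : Fin n → ℂ)) (inner ℂ (szegoVec z) f) := by
  have h := lp.hasSum_inner (𝕜 := ℂ) (G := fun _ : Fin n → ℕ => ℂ) (szegoVec z) f
  refine h.congr_fun fun m => ?_
  change _ = f.coeff m * star (star (monomial m (z : Fin n → ℂ)))
  rw [star_star]

/-- The function `z ↦ ∑ a_m z ^ m` on the polydisc. -/
def eval (f : HardySpace n) (z : polydisc n) : ℂ := ∑' m, f.coeff m * monomial m (z : Fin n → ℂ)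

theorem eval_eq_inner (f : HardySpace n) (z : polydisc n) :
    f.eval z = inner ℂ (szegoVec z) f := (hasSum_eval f z).tsum_eq

theorem coeff_eq_zero_of_eval_eq_zero (f : HardySpace n) (hf : ∀ z, f.eval z = 0)
    (m : Fin n → ℕ) : f.coeff m = 0 := by
  classical
  let e : (Fin n → ℕ) → (Fin n → ℤ) := fun m i => (m i : ℤ)
  have he : Function.Injective e := fun a b h => funext fun i => by
    have := congrFun h i
    simpa [e] using this
  let c : (Fin n → ℕ) → ℂ := fun m => f.coeff m * ∏ i, (1 / 2 : ℂ) ^ m i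
  have hgeo : Summable fun m : Fin n → ℕ => ‖∏ i : Fin n, (1 / 2 : ℂ) ^ m i‖ :=
    (hasSum_geometric_multi (fun _ : Fin n => (1 / 2 : ℂ)) (fun _ => by norm_num)).1
  have hbd : ∀ m, ‖f.coeff m‖ ≤ ‖f‖ := fun m =>
    lp.norm_apply_le_norm (E := fun _ : Fin n → ℕ => ℂ) (by norm_num) f m
  have hc : Summable fun m => c m • (UnitAddTorus.mFourier (e m) : C(UnitAddTorus (Fin n), ℂ)) := by
    refine Summable.of_norm_bounded (hgeo.mul_left ‖f‖) fun m => ?_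
    rw [norm_smul, UnitAddTorus.mFourier_norm, mul_one, norm_mul]
    exact mul_le_mul_of_nonneg_right (hbd m) (norm_nonneg _)
  have h0 : HasSum (fun m => c m • (UnitAddTorus.mFourier (e m) : C(UnitAddTorus (Fin n), ℂ))) 0 := by
    convert hc.hasSum
    ext t
    have ht := (ContinuousMap.evalCLM ℂ t).hasSum hc.hasSum
    have hz : (fun i => (1 / 2 : ℂ) * (AddCircle.toCircle (t i) : ℂ)) ∈ polydisc n := fun i => by
      rw [norm_mul, Circle.norm_coe]
      norm_num
    have hs := hasSum_eval f ⟨_, hz⟩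
    rw [← eval_eq_inner, hf] at hs
    refine (hs.congr_fun fun m => ?_).unique ht
    have hexp : ∀ i, ((m i • t i).toCircle : ℂ) = (AddCircle.toCircle (t i) : ℂ) ^ m i := fun i => by
      rw [AddCircle.toCircle_nsmul, Circle.coe_pow]
    simp [c, e, monomial, UnitAddTorus.mFourier, mul_pow, Finset.prod_mul_distrib, fourier_apply,
      hexp, mul_assoc]
  let T := ContinuousMap.toLp (E := ℂ) 2
    (MeasureTheory.Measure.pi fun _ : Fin n => AddCircle.haarAddCircle (T := 1)) ℂ
  have ho : ∀ a b : Fin n → ℤ, inner ℂ (T (UnitAddTorus.mFourier a))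
      (T (UnitAddTorus.mFourier b)) = if a = b then (1 : ℂ) else 0 :=
    orthonormal_iff_ite.1 (UnitAddTorus.orthonormal_mFourier (d := Fin n))
  have h2 := (innerSL ℂ (T (UnitAddTorus.mFourier (e m)))).hasSum (T.hasSum h0)
  simp only [map_smul, map_zero, innerSL_apply_apply, ho, he.eq_iff] at h2
  have h5 : c m = 0 := by
    have h3 := hasSum_single (f := fun k => c k • if m = k then (1 : ℂ) else 0) m
      fun k hk => by simp [hk.symm]
    simpa using h3.unique h2
  exact (mul_eq_zero.1 h5).resolve_right
    (Finset.prod_ne_zero_iff.2 fun i _ => pow_ne_zero _ (by norm_num))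

theorem szegoVec_coeff (z : polydisc n) (m : Fin n → ℕ) :
    (szegoVec z).coeff m = star (monomial m (z : Fin n → ℂ)) := rfl

/-- The Hardy space as a reproducing kernel Hilbert space of functions on the polydisc. -/
instance : RKHS ℂ (HardySpace n) (polydisc n) ℂ where
  coeCLM :=
    { toFun := fun f z => f.eval z
      map_add' := fun f g => funext fun z => by simp [eval_eq_inner]
      map_smul' := fun c f => funext fun z => by simp [eval_eq_inner]
      cont := by
        simp only [eval_eq_inner]
        fun_prop }
  coeCLM_injective := by
    refine (injective_iff_map_eq_zero _).2 fun f hf => ?_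
    refine lp.ext (funext fun m => ?_)
    exact coeff_eq_zero_of_eval_eq_zero f (fun z => congrFun hf z) m

/-- The value of `f` at `z` is the sum of its power series. -/
theorem hasSum_apply (f : HardySpace n) (z : polydisc n) :
    HasSum (fun m => f.coeff m * monomial m (z : Fin n → ℂ)) (f z) := by
  have h := hasSum_eval f z
  rw [← eval_eq_inner] at h
  exact h

/-- The reproducing kernel of the Hardy space is the Szegő kernel of the polydisc. -/
theorem kernel_eq (z w : polydisc n) :
    RKHS.kernel (HardySpace n) z w =
      (∏ i, (1 - (z : Fin n → ℂ) i * star ((w : Fin n → ℂ) i))⁻¹) •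
        ContinuousLinearMap.id ℂ ℂ := by
  have hker : ∀ w : polydisc n, RKHS.kerFun (HardySpace n) w 1 = szegoVec w := fun w => by
    refine ext_inner_right ℂ fun f => ?_
    rw [RKHS.kerFun_inner, ← eval_eq_inner]
    simp
    rfl
  refine ContinuousLinearMap.ext_ring ?_
  rw [← RKHS.kerFun_apply, hker]
  have hx : ∀ i, ‖(z : Fin n → ℂ) i * star ((w : Fin n → ℂ) i)‖ < 1 := fun i => by
    rw [norm_mul, norm_star]
    exact mul_lt_one_of_nonneg_of_lt_one_left (norm_nonneg _) (z.2 i) (w.2 i).le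
  have h := (hasSum_geometric_multi _ hx).2
  have h' := hasSum_apply (szegoVec w) z
  refine (h'.congr_fun fun m => ?_).unique (by simpa using h)
  simp [szegoVec_coeff, monomial, mul_pow, Finset.prod_mul_distrib, mul_comm]

end HardySpace

/-- The normalized Lebesgue (Haar) measure on the torus `𝕋ⁿ`, parametrized as `(ℝ / ℤ)ⁿ`. -/
def torusMeasure (n : ℕ) : MeasureTheory.Measure (UnitAddTorus (Fin n)) :=
  MeasureTheory.Measure.pi fun _ => AddCircle.haarAddCircle

/-- The point `(e ^ (2 π i t₁), …, e ^ (2 π i tₙ))` of the distinguished boundary `𝕋ⁿ ⊆ ℂⁿ`. -/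
def torusPoint {n : ℕ} (t : UnitAddTorus (Fin n)) : Fin n → ℂ :=
  fun i => (AddCircle.toCircle (t i) : ℂ)

/-- `θ ∈ H^∞(𝔻ⁿ)`: holomorphic and bounded on the polydisc. -/
def IsHInfty {n : ℕ} (θ : (Fin n → ℂ) → ℂ) : Prop :=
  DifferentiableOn ℂ θ (polydisc n) ∧ ∃ C : ℝ, ∀ z ∈ polydisc n, ‖θ z‖ ≤ C

/-- `θ` is an inner function: `θ ∈ H^∞(𝔻ⁿ)` and, for almost every `ζ ∈ 𝕋ⁿ`, the radial boundary
value `lim_{r → 1⁻} θ (r ζ)` has modulus one. -/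
def IsInner {n : ℕ} (θ : (Fin n → ℂ) → ℂ) : Prop :=
  IsHInfty θ ∧ ∀ᵐ t ∂(torusMeasure n), ∃ L : ℂ,
    Tendsto (fun r : ℝ => θ ((r : ℂ) • torusPoint t)) (𝓝[<] 1) (𝓝 L) ∧ ‖L‖ = 1

/-- `M` is the operator `M_θ` of multiplication by `θ` on `H²(𝔻ⁿ)`: `(M f)(z) = θ(z) f(z)`. -/
def IsMulOperator {n : ℕ} (θ : (Fin n → ℂ) → ℂ) (M : HardySpace n →L[ℂ] HardySpace n) : Prop :=
  ∀ (f : HardySpace n) (z : polydisc n), M f z = θ z * f z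

section Operators

variable {H : Type*} [NormedAddCommGroup H] [InnerProductSpace ℂ H] [CompleteSpace H]

/-- A contraction `T` is pure if `T*ᵐ → 0` in the strong operator topology. -/
def IsPureContraction (T : H →L[ℂ] H) : Prop :=
  ‖T‖ ≤ 1 ∧ ∀ h : H, Tendsto (fun m : ℕ => ‖((ContinuousLinearMap.adjoint T) ^ m) h‖) atTop (𝓝 0)

/-- A pure isometry is an isometry that is a pure contraction. -/
def IsPureIsometry (T : H →L[ℂ] H) : Prop :=
  Isometry T ∧ IsPureContraction T

end Operators

end PolydiscHardy

end

noncomputable section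

namespace PolydiscHardy

open MeasureTheory UnitAddTorus ComplexConjugate

/-! Isometry: since `|θ| = 1` almost everywhere on the torus, the functions `θ z ^ m` are
orthonormal, and `M_θ` is the linear isometry sending the basis `z ^ m` to them
(`IsInner.exists_isMulOperator`). Their inner products are limits, as `r → 1`, of integrals over
tori of radius `r` (`Represents.tendsto_inner`), evaluated by dominated convergence
(`IsInner.tendsto_integral`). Only `θ` needs boundary values, never a general `f`.

Underneath lies the Fourier description of a holomorphic `F`: on the torus through `z`, its
coefficient at `m ≥ 0` is `a m * z ^ m` with `a` independent of `z`, and all others vanish. With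
Parseval this puts bounded `F` in the Hardy space (`exists_represents`).

Purity: the Szegő vector at `z` is an eigenvector of the adjoint with eigenvalue `conj (θ z)`. As
the adjoint is a contraction, `|θ| ≤ 1`, and the maximum principle makes this strict. So the powers
of the adjoint tend to zero on the dense span of these vectors, hence everywhere
(`tendsto_pow_apply_of_dense`). -/

instance (n : ℕ) : IsProbabilityMeasure (torusMeasure n) :=
  inferInstanceAs (IsProbabilityMeasure (Measure.pi fun _ : Fin n => AddCircle.haarAddCircle))

instance (n : ℕ) : (torusMeasure n).IsAddHaarMeasure :=
  inferInstanceAs (Measure.pi fun _ : Fin n => AddCircle.haarAddCircle).IsAddHaarMeasure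

/-! ### Fourier analysis on the circle and the torus -/

/-- Fourier coefficients on circles of a holomorphic function on the unit disc. -/
theorem exists_integral_circle_eq {g : ℂ → ℂ} (hg : DifferentiableOn ℂ g (Metric.ball 0 1)) :
    ∃ p : ℕ → ℂ, ∀ w : ℂ, ‖w‖ < 1 → ∀ k : ℤ,
      ∫ u : UnitAddCircle, fourier (-k) u * g (w * (AddCircle.toCircle u : ℂ))
        ∂AddCircle.haarAddCircle = if 0 ≤ k then p k.toNat * w ^ k.toNat else 0 := by
  refine ⟨fun j => (j.factorial : ℂ)⁻¹ * iteratedDeriv j g 0, fun w hw k => ?_⟩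
  set p : ℕ → ℂ := fun j => (j.factorial : ℂ)⁻¹ * iteratedDeriv j g 0
  have hp : ∀ z : ℂ, ‖z‖ < 1 → HasSum (fun j => p j * z ^ j) (g z) := fun z hz => by
    have h := Complex.hasSum_taylorSeries_on_ball hg (z := z) (by simpa using hz)
    refine h.congr_fun fun j => ?_
    simp only [p, sub_zero, smul_eq_mul]
    ring
  have hs : Summable fun j : ℕ => (p j * w ^ j) • (fourier (j : ℤ) : C(UnitAddCircle, ℂ)) := by
    refine Summable.of_norm_bounded (hp w hw).summable.norm fun j => ?_
    rw [norm_smul, fourier_norm, mul_one]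
  have hG : ∀ u, (∑' j : ℕ, (p j * w ^ j) • (fourier (j : ℤ) : C(UnitAddCircle, ℂ))) u =
      g (w * (AddCircle.toCircle u : ℂ)) := fun u => by
    have h1 := (ContinuousMap.evalCLM ℂ u).hasSum hs.hasSum
    have h2 := hp (w * (AddCircle.toCircle u : ℂ)) (by rwa [norm_mul, Circle.norm_coe, mul_one])
    refine h1.unique (h2.congr_fun fun j => ?_)
    simp [fourier_apply, AddCircle.toCircle_nsmul, Circle.coe_pow, mul_pow, mul_assoc]
  -- The Taylor series on the circle converges uniformly, hence in `L²`, so orthonormality of the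
  -- characters reads off each coefficient.
  let T := ContinuousMap.toLp (E := ℂ) 2 (AddCircle.haarAddCircle (T := 1)) ℂ
  have ho : ∀ a b : ℤ, inner ℂ (T (fourier a)) (T (fourier b)) = if a = b then (1 : ℂ) else 0 :=
    orthonormal_iff_ite.1 (orthonormal_fourier (T := 1))
  have h2 := (innerSL ℂ (T (fourier k))).hasSum (T.hasSum hs.hasSum)
  simp only [map_smul, innerSL_apply_apply, ho] at h2
  have h3 : inner ℂ (T (fourier k))
      (T (∑' j : ℕ, (p j * w ^ j) • (fourier (j : ℤ) : C(UnitAddCircle, ℂ)))) =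
      ∫ u : UnitAddCircle, fourier (-k) u * g (w * (AddCircle.toCircle u : ℂ))
        ∂AddCircle.haarAddCircle := by
    rw [ContinuousMap.inner_toLp]
    refine integral_congr_ae (.of_forall fun u => ?_)
    simp only [hG, fourier_neg]
    ring
  rw [← h3]
  refine h2.unique ?_
  split_ifs with hk
  · have h4 := hasSum_single (f := fun j : ℕ => (p j * w ^ j) • if k = j then (1 : ℂ) else 0)
      k.toNat fun j hj => by
        rw [if_neg (by omega), smul_zero]
    simpa [Int.toNat_of_nonneg hk] using h4
  · refine hasSum_zero.congr_fun fun j => ?_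
    rw [if_neg (by omega), smul_zero]

theorem mFourierCoeff_eq {n : ℕ} (f : UnitAddTorus (Fin n) → ℂ) (k : Fin n → ℤ) :
    mFourierCoeff f k = ∫ t, mFourier (-k) t * f t ∂torusMeasure n := rfl

/-- **Parseval's identity** for continuous functions on the torus. -/
theorem hasSum_conj_mFourierCoeff_mul {n : ℕ} (f g : C(UnitAddTorus (Fin n), ℂ)) :
    HasSum (fun k => conj (mFourierCoeff f k) * mFourierCoeff g k)
      (∫ t, conj (f t) * g t ∂torusMeasure n) := by
  have h := hasSum_prod_mFourierCoeff (f.toLp 2 (torusMeasure n) ℂ) (g.toLp 2 (torusMeasure n) ℂ)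
  have e : ∀ (f : C(UnitAddTorus (Fin n), ℂ)) k,
      mFourierCoeff (f.toLp 2 (torusMeasure n) ℂ) k = mFourierCoeff f k := mFourierCoeff_toLp
  have h' : HasSum (fun k => conj (mFourierCoeff f k) * mFourierCoeff g k)
      (∫ t, conj (f.toLp 2 (torusMeasure n) ℂ t) * g.toLp 2 (torusMeasure n) ℂ t
        ∂torusMeasure n) :=
    h.congr_fun fun k => by
      rw [← e f k, ← e g k]
      rfl
  convert h' using 1
  refine integral_congr_ae ?_
  filter_upwards [f.coeFn_toLp (p := 2) (𝕜 := ℂ) (torusMeasure n),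
    g.coeFn_toLp (p := 2) (𝕜 := ℂ) (torusMeasure n)] with t h1 h2
  rw [h1, h2]

/-- The integral of a continuous function on the torus is unchanged by averaging over rotations of
one coordinate. -/
theorem integral_torus_eq_integral_integral_rotate {n : ℕ} (G : C(UnitAddTorus (Fin n), ℂ))
    (i : Fin n) :
    ∫ t, G t ∂torusMeasure n =
      ∫ t, ∫ u : UnitAddCircle, G (t + Pi.single i u) ∂AddCircle.haarAddCircle ∂torusMeasure n := by
  have hc : Continuous fun q : UnitAddTorus (Fin n) × UnitAddCircle => G (q.1 + Pi.single i q.2) :=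
    G.continuous.comp (continuous_fst.add ((continuous_single i).comp continuous_snd))
  rw [integral_integral_swap]
  -- After Fubini, translation invariance of Haar measure makes the inner integral independent of
  -- `u`.
  · have : ∀ u : UnitAddCircle, ∫ t, G (t + Pi.single i u) ∂torusMeasure n =
        ∫ t, G t ∂torusMeasure n := fun u =>
      integral_add_right_eq_self (μ := torusMeasure n) (fun t => G t) _
    simp only [this]
    simp
  · exact hc.integrable_of_hasCompactSupport (HasCompactSupport.of_compactSpace _)

/-! ### Fourier coefficients of holomorphic functions on tori -/

variable {n : ℕ}

theorem norm_torusPoint (t : UnitAddTorus (Fin n)) (i : Fin n) : ‖torusPoint t i‖ = 1 :=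
  Circle.norm_coe _

theorem continuous_torusPoint : Continuous (torusPoint : UnitAddTorus (Fin n) → Fin n → ℂ) :=
  continuous_pi fun i => continuous_subtype_val.comp
    (AddCircle.continuous_toCircle.comp (continuous_apply i))

theorem mul_torusPoint_mem {z : Fin n → ℂ} (hz : z ∈ polydisc n) (t : UnitAddTorus (Fin n)) :
    z * torusPoint t ∈ polydisc n := fun i => by
  rw [Pi.mul_apply, norm_mul, norm_torusPoint, mul_one]
  exact hz i

theorem update_mem_polydisc {z : Fin n → ℂ} (hz : z ∈ polydisc n) (i : Fin n) {s : ℂ}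
    (hs : ‖s‖ < 1) : Function.update z i s ∈ polydisc n := fun j => by
  rcases eq_or_ne j i with rfl | h
  · simpa using hs
  · simpa [h] using hz j

/-- The function `t ↦ F (z₁ e ^ (2 π i t₁), …, zₙ e ^ (2 π i tₙ))` on the torus. -/
def torusSlice {F : (Fin n → ℂ) → ℂ} (hF : ContinuousOn F (polydisc n)) {z : Fin n → ℂ}
    (hz : z ∈ polydisc n) : C(UnitAddTorus (Fin n), ℂ) where
  toFun t := F (z * torusPoint t)
  continuous_toFun := hF.comp_continuous (continuous_const.mul continuous_torusPoint)
    (mul_torusPoint_mem hz)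

/-- Dependence of the Fourier coefficients of torus slices on a single coordinate. -/
theorem exists_mFourierCoeff_update {F : (Fin n → ℂ) → ℂ} (hF : DifferentiableOn ℂ F (polydisc n))
    {z : Fin n → ℂ} (hz : z ∈ polydisc n) (k : Fin n → ℤ) (i : Fin n) :
    ∃ A : ℂ, ∀ s : ℂ, ‖s‖ < 1 →
      mFourierCoeff (fun t => F (Function.update z i s * torusPoint t)) k =
        if 0 ≤ k i then A * s ^ (k i).toNat else 0 := by
  have hp : ∀ t : UnitAddTorus (Fin n), _ := fun t =>
    exists_integral_circle_eq (g := fun l => F (Function.update (z * torusPoint t) i l)) (by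
      refine hF.comp (fun l _ => ?_) fun l hl => update_mem_polydisc (mul_torusPoint_mem hz t) i
        (by simpa using hl)
      exact (hasFDerivAt_update (𝕜 := ℂ) (E := fun _ : Fin n => ℂ) _ l).differentiableAt.differentiableWithinAt)
  choose p hp using hp
  -- Rotating coordinate `i` first reduces to one variable, with `w = s * torusPoint t i`. The
  -- Taylor coefficients `p t` do not see `s`, because the slot `i` is overwritten, so `s ^ (k
  -- i).toNat` factors out.
  refine ⟨∫ t, mFourier (-k) t * (p t (k i).toNat * torusPoint t i ^ (k i).toNat) ∂torusMeasure n,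
    fun s hs => ?_⟩
  have hz' := update_mem_polydisc hz i hs
  rw [mFourierCoeff_eq]
  have h := integral_torus_eq_integral_integral_rotate
    (mFourier (-k) * torusSlice hF.continuousOn hz') i
  have e1 : ∀ t (u : UnitAddCircle), (mFourier (-k) * torusSlice hF.continuousOn hz')
      (t + Pi.single i u) = mFourier (-k) t * (fourier (-k i) u *
        F (Function.update (z * torusPoint t) i (s * torusPoint t i * (AddCircle.toCircle u : ℂ))))
      := fun t u => by
    rw [ContinuousMap.mul_apply, ← mul_assoc]
    congr 1
    · simp only [mFourier, ContinuousMap.coe_mk, Pi.neg_apply, Pi.add_apply]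
      have : ∀ j, fourier (-k j) (t j + (Pi.single i u : UnitAddTorus (Fin n)) j) =
          fourier (-k j) (t j) * if j = i then (fourier (-k i) u : ℂ) else 1 := fun j => by
        rcases eq_or_ne j i with rfl | hj
        · simp [fourier_apply, smul_add, AddCircle.toCircle_add]
        · simp [hj]
      simp only [this, Finset.prod_mul_distrib]
      simp
    · change F _ = F _
      congr 1
      ext j
      rcases eq_or_ne j i with rfl | hj
      · simp [torusPoint, AddCircle.toCircle_add, mul_assoc]
      · simp [torusPoint, hj]
  simp only [e1, integral_const_mul] at h
  refine h.trans ?_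
  have e2 : ∀ t, ‖s * torusPoint t i‖ < 1 := fun t => by
    rwa [norm_mul, norm_torusPoint, mul_one]
  simp only [fun t => hp t _ (e2 t) (k i)]
  split_ifs
  · rw [← integral_mul_const]
    refine integral_congr_ae (.of_forall fun t => ?_)
    simp only [mul_pow]
    ring
  · simp

theorem mFourierCoeff_slice_eq_zero {F : (Fin n → ℂ) → ℂ}
    (hF : DifferentiableOn ℂ F (polydisc n)) {z : Fin n → ℂ} (hz : z ∈ polydisc n)
    {k : Fin n → ℤ} {i : Fin n} (hk : k i < 0) :
    mFourierCoeff (fun t => F (z * torusPoint t)) k = 0 := by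
  obtain ⟨A, hA⟩ := exists_mFourierCoeff_update hF hz k i
  simpa [hk.not_ge] using hA (z i) (hz i)

/-- Says without division that coefficient over monomial does not depend on the base point, so
points with zero coordinates are allowed. -/
theorem mFourierCoeff_slice_mul_monomial {F : (Fin n → ℂ) → ℂ}
    (hF : DifferentiableOn ℂ F (polydisc n)) {z w : Fin n → ℂ} (hz : z ∈ polydisc n)
    (hw : w ∈ polydisc n) (m : Fin n → ℕ) :
    mFourierCoeff (fun t => F (z * torusPoint t)) (fun i => (m i : ℤ)) * monomial m w =
      mFourierCoeff (fun t => F (w * torusPoint t)) (fun i => (m i : ℤ)) * monomial m z := by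
  -- Coordinates of `z` are exchanged for those of `w` one at a time; `S` records those already
  -- exchanged.
  suffices H : ∀ S : Finset (Fin n), S.piecewise w z ∈ polydisc n ∧
      mFourierCoeff (fun t => F (z * torusPoint t)) (fun i => (m i : ℤ)) * ∏ i ∈ S, w i ^ m i =
      mFourierCoeff (fun t => F (S.piecewise w z * torusPoint t)) (fun i => (m i : ℤ)) *
        ∏ i ∈ S, z i ^ m i by
    simpa [monomial] using (H Finset.univ).2
  intro S
  induction S using Finset.induction_on with
  | empty => simpa using hz
  | insert i S hi ih =>
    rw [Finset.piecewise_insert]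
    refine ⟨update_mem_polydisc ih.1 i (hw i), ?_⟩
    obtain ⟨A, hA⟩ := exists_mFourierCoeff_update hF ih.1 (fun i => (m i : ℤ)) i
    have h1 := hA (w i) (hw i)
    have h2 := hA (z i) (hz i)
    have h3 : Function.update (S.piecewise w z) i (z i) = S.piecewise w z := by
      have : z i = S.piecewise w z i := by simp [hi]
      rw [this, Function.update_eq_self]
    rw [h3] at h2
    simp only [Nat.cast_nonneg, if_true, Int.toNat_natCast] at h1 h2
    rw [h1, Finset.prod_insert hi, Finset.prod_insert hi, mul_left_comm, ih.2, h2]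
    ring

/-- The Fourier coefficients of the torus slices of a holomorphic function on the polydisc. -/
theorem exists_mFourierCoeff_slice_eq {F : (Fin n → ℂ) → ℂ}
    (hF : DifferentiableOn ℂ F (polydisc n)) :
    ∃ a : (Fin n → ℕ) → ℂ, ∀ z ∈ polydisc n, ∀ m : Fin n → ℕ,
      mFourierCoeff (fun t => F (z * torusPoint t)) (fun i => (m i : ℤ)) = a m * monomial m z := by
  -- Any base point with no zero coordinate would serve to define `a`.
  have hw : (fun _ => 1 / 2 : Fin n → ℂ) ∈ polydisc n := fun i => by norm_num
  refine ⟨fun m => mFourierCoeff (fun t => F ((fun _ => 1 / 2 : Fin n → ℂ) * torusPoint t))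
    (fun i => (m i : ℤ)) / monomial m (fun _ => 1 / 2), fun z hz m => ?_⟩
  have h0 : monomial m (fun _ : Fin n => (1 / 2 : ℂ)) ≠ 0 :=
    Finset.prod_ne_zero_iff.2 fun i _ => pow_ne_zero _ (by norm_num)
  rw [div_mul_eq_mul_div, eq_div_iff h0]
  exact mFourierCoeff_slice_mul_monomial hF hz hw m

theorem natCast_comp_injective :
    Function.Injective fun (m : Fin n → ℕ) (i : Fin n) => (m i : ℤ) := fun a b h =>
  funext fun i => by simpa using congrFun h i

theorem exists_neg_of_notMem_range {k : Fin n → ℤ}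
    (hk : k ∉ Set.range fun (m : Fin n → ℕ) (i : Fin n) => (m i : ℤ)) : ∃ i, k i < 0 := by
  by_contra! h
  exact hk ⟨fun i => (k i).toNat, funext fun i => Int.toNat_of_nonneg (h i)⟩

/-! ### Holomorphic functions as elements of the Hardy space -/

/-- `f` represents `F`: the torus slices of `F` have the Fourier coefficients of `f`. -/
def Represents (f : HardySpace n) (F : (Fin n → ℂ) → ℂ) : Prop :=
  ∀ z ∈ polydisc n, ∀ m : Fin n → ℕ,
    mFourierCoeff (fun t => F (z * torusPoint t)) (fun i => (m i : ℤ)) = f.coeff m * monomial m z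

theorem Represents.apply_eq {f : HardySpace n} {F : (Fin n → ℂ) → ℂ} (h : Represents f F)
    (hF : DifferentiableOn ℂ F (polydisc n)) (z : polydisc n) : f z = F z := by
  have hz := z.2
  set c := mFourierCoeff (torusSlice hF.continuousOn hz) with hc
  have h1 := HardySpace.hasSum_apply f z
  have h0 : ∀ k ∉ Set.range fun (m : Fin n → ℕ) (i : Fin n) => (m i : ℤ), c k = 0 := fun k hk =>
    mFourierCoeff_slice_eq_zero hF hz (exists_neg_of_notMem_range hk).choose_spec
  have h2 : HasSum c (f z) := by
    refine (natCast_comp_injective.hasSum_iff h0).1 (h1.congr_fun fun m => ?_)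
    exact h z hz m
  -- The coefficients sum to `f z`; summability makes the Fourier series converge pointwise, and at
  -- `t = 0` it gives `F z`.
  have h3 := hasSum_mFourier_series_apply_of_summable (f := torusSlice hF.continuousOn hz)
    h2.summable 0
  have h4 : torusSlice hF.continuousOn hz 0 = F z := by
    change F _ = F _
    congr 1
    ext i
    simp [torusPoint]
  rw [h4] at h3
  refine h2.unique (h3.congr_fun fun k => ?_)
  simp [mFourier, hc]

/-- Parseval's identity on the torus `{(z₁ ζ₁, …, zₙ ζₙ) | ζ ∈ 𝕋ⁿ}`. -/
theorem hasSum_slice {F G : (Fin n → ℂ) → ℂ} {a b : (Fin n → ℕ) → ℂ} {z : Fin n → ℂ}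
    (hz : z ∈ polydisc n)
    (hF : DifferentiableOn ℂ F (polydisc n)) (hG : DifferentiableOn ℂ G (polydisc n))
    (ha : ∀ m : Fin n → ℕ,
      mFourierCoeff (fun t => F (z * torusPoint t)) (fun i => (m i : ℤ)) = a m * monomial m z)
    (hb : ∀ m : Fin n → ℕ,
      mFourierCoeff (fun t => G (z * torusPoint t)) (fun i => (m i : ℤ)) = b m * monomial m z) :
    HasSum (fun m => conj (a m) * b m * (‖monomial m z‖ ^ 2 : ℝ))
      (∫ t, conj (F (z * torusPoint t)) * G (z * torusPoint t) ∂torusMeasure n) := by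
  have h := hasSum_conj_mFourierCoeff_mul (torusSlice hF.continuousOn hz)
    (torusSlice hG.continuousOn hz)
  refine ((natCast_comp_injective.hasSum_iff fun k hk => ?_).2 h).congr_fun fun m => ?_
  · have : mFourierCoeff (torusSlice hF.continuousOn hz) k = 0 :=
      mFourierCoeff_slice_eq_zero hF hz (exists_neg_of_notMem_range hk).choose_spec
    rw [this, map_zero, zero_mul]
  · have e1 : mFourierCoeff (torusSlice hF.continuousOn hz) (fun i => (m i : ℤ)) = _ := ha m
    have e2 : mFourierCoeff (torusSlice hG.continuousOn hz) (fun i => (m i : ℤ)) = _ := hb m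
    simp only [Function.comp_apply, e1, e2, map_mul]
    rw [← Complex.normSq_eq_norm_sq, Complex.normSq_eq_conj_mul_self]
    ring

theorem const_mem_polydisc {r : ℝ} (hr : r ∈ Set.Ioo (0 : ℝ) 1) :
    (fun _ => (r : ℂ)) ∈ polydisc n := fun _ => by
  rw [Complex.norm_real, Real.norm_of_nonneg hr.1.le]
  exact hr.2

theorem smul_torusPoint_mem {r : ℝ} (hr : r ∈ Set.Ioo (0 : ℝ) 1) (t : UnitAddTorus (Fin n)) :
    (r : ℂ) • torusPoint t ∈ polydisc n :=
  mul_torusPoint_mem (const_mem_polydisc hr) t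

theorem Ioo_mem_nhdsLT_one : Set.Ioo (0 : ℝ) 1 ∈ 𝓝[<] (1 : ℝ) := Ioo_mem_nhdsLT one_pos

theorem continuous_monomial (m : Fin n → ℕ) : Continuous (monomial m : (Fin n → ℂ) → ℂ) :=
  continuous_finsetProd _ fun i _ => (continuous_apply i).pow _

theorem differentiable_monomial (m : Fin n → ℕ) :
    Differentiable ℂ (monomial m : (Fin n → ℂ) → ℂ) := by
  unfold monomial
  fun_prop

theorem norm_monomial_le_one (m : Fin n → ℕ) {z : Fin n → ℂ} (hz : z ∈ polydisc n) :
    ‖monomial m z‖ ≤ 1 := by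
  rw [monomial, norm_prod]
  refine Finset.prod_le_one (fun i _ => norm_nonneg _) fun i _ => ?_
  rw [norm_pow]
  exact pow_le_one₀ (norm_nonneg _) (hz i).le

theorem tendsto_norm_monomial_const (m : Fin n → ℕ) :
    Tendsto (fun r : ℝ => (‖monomial m (fun _ => (r : ℂ))‖ ^ 2 : ℝ)) (𝓝[<] 1) (𝓝 1) := by
  have h : Continuous fun r : ℝ => (‖monomial m (fun _ : Fin n => (r : ℂ))‖ ^ 2 : ℝ) :=
    ((continuous_monomial m).comp (continuous_pi fun _ => Complex.continuous_ofReal)).norm.pow 2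
  have := (h.tendsto 1).mono_left (nhdsWithin_le_nhds (s := Set.Iio 1))
  simpa [monomial] using this

/-- A bounded holomorphic function on the polydisc belongs to the Hardy space. -/
theorem exists_represents {F : (Fin n → ℂ) → ℂ} (hF : DifferentiableOn ℂ F (polydisc n)) {C : ℝ}
    (hC : ∀ z ∈ polydisc n, ‖F z‖ ≤ C) : ∃ f : HardySpace n, Represents f F := by
  obtain ⟨a, ha⟩ := exists_mFourierCoeff_slice_eq hF
  have hfin : ∀ S : Finset (Fin n → ℕ), ∑ m ∈ S, ‖a m‖ ^ 2 ≤ C ^ 2 := fun S => by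
    -- At each radius `r < 1` Parseval bounds the weighted finite sum by `C ^ 2`; letting `r → 1`
    -- removes the weights.
    have hlim : Tendsto (fun r : ℝ => ∑ m ∈ S, ‖a m‖ ^ 2 * ‖monomial m (fun _ => (r : ℂ))‖ ^ 2)
        (𝓝[<] 1) (𝓝 (∑ m ∈ S, ‖a m‖ ^ 2 * 1)) :=
      tendsto_finsetSum _ fun m _ => (tendsto_norm_monomial_const m).const_mul _
    simp only [mul_one] at hlim
    refine le_of_tendsto hlim ?_
    filter_upwards [Ioo_mem_nhdsLT_one] with r hr
    have hz := const_mem_polydisc (n := n) hr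
    have h := Complex.hasSum_re (hasSum_slice hz hF hF (ha _ hz) (ha _ hz))
    have e : ∀ w : ℂ, conj w * w = ((‖w‖ ^ 2 : ℝ) : ℂ) := fun w => by
      rw [← Complex.normSq_eq_norm_sq, Complex.normSq_eq_conj_mul_self]
    simp only [e, integral_complex_ofReal, ← Complex.ofReal_mul, Complex.ofReal_re] at h
    refine (sum_le_hasSum S (fun m _ => by positivity) h).trans ?_
    have h1 := norm_integral_le_of_norm_le_const (μ := torusMeasure n)
      (f := fun t => ‖F ((fun _ => (r : ℂ)) * torusPoint t)‖ ^ 2) (C := C ^ 2)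
      (.of_forall fun t => by
        rw [norm_pow, norm_norm]
        exact pow_le_pow_left₀ (norm_nonneg _) (hC _ (mul_torusPoint_mem hz t)) 2)
    simpa using (le_abs_self _).trans h1
  refine ⟨(⟨a, memℓp_gen ?_⟩ : lp (fun _ : Fin n → ℕ => ℂ) 2), ha⟩
  simpa using summable_of_sum_le (fun m => by positivity) hfin

/-- The Hardy space inner product as a limit of integrals over tori of radius `r < 1`. -/
theorem Represents.tendsto_inner {f g : HardySpace n} {F G : (Fin n → ℂ) → ℂ}
    (hf : Represents f F) (hg : Represents g G)
    (hF : DifferentiableOn ℂ F (polydisc n)) (hG : DifferentiableOn ℂ G (polydisc n)) :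
    Tendsto (fun r : ℝ => ∫ t, conj (F ((r : ℂ) • torusPoint t)) * G ((r : ℂ) • torusPoint t)
      ∂torusMeasure n) (𝓝[<] 1) (𝓝 (inner ℂ f g)) := by
  have hsum : Summable fun m => inner ℂ (f.coeff m) (g.coeff m) :=
    lp.summable_inner (𝕜 := ℂ) (G := fun _ : Fin n → ℕ => ℂ) f g
  have hin : ∀ a b : ℂ, inner ℂ a b = conj a * b := fun a b => by
    rw [RCLike.inner_apply, mul_comm]
  rw [HardySpace.inner_eq]
  simp only [hin] at hsum ⊢
  have h : Tendsto (fun r : ℝ => ∑' m, conj (f.coeff m) * g.coeff m *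
      (‖monomial m (fun _ => (r : ℂ))‖ ^ 2 : ℝ)) (𝓝[<] 1)
      (𝓝 (∑' m, conj (f.coeff m) * g.coeff m)) := by
    refine tendsto_tsum_of_dominated_convergence hsum.norm (fun m => ?_) ?_
    · simpa using ((Complex.continuous_ofReal.tendsto 1).comp
        (tendsto_norm_monomial_const m)).const_mul (conj (f.coeff m) * g.coeff m)
    · filter_upwards [Ioo_mem_nhdsLT_one] with r hr m
      rw [norm_mul, Complex.norm_real, norm_pow, norm_norm]
      exact mul_le_of_le_one_right (norm_nonneg _)
        (pow_le_one₀ (norm_nonneg _) (norm_monomial_le_one m (const_mem_polydisc hr)))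
  refine h.congr' ?_
  filter_upwards [Ioo_mem_nhdsLT_one] with r hr
  have hz := const_mem_polydisc (n := n) hr
  exact (hasSum_slice hz hF hG (hf _ hz) (hg _ hz)).tsum_eq

/-! ### Inner functions and the multiplication isometry -/

theorem monomial_torusPoint (m : Fin n → ℕ) (t : UnitAddTorus (Fin n)) :
    monomial m (torusPoint t) = mFourier (fun i => (m i : ℤ)) t := by
  simp [monomial, mFourier, torusPoint, fourier_apply, AddCircle.toCircle_nsmul]

theorem integral_conj_monomial_mul (m k : Fin n → ℕ) :
    ∫ t, conj (monomial m (torusPoint t)) * monomial k (torusPoint t) ∂torusMeasure n =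
      if m = k then 1 else 0 := by
  have ho := orthonormal_iff_ite.1 (orthonormal_mFourier (d := Fin n))
    (fun i => (m i : ℤ)) (fun i => (k i : ℤ))
  have h : inner ℂ ((mFourier fun i => (m i : ℤ)).toLp 2 (torusMeasure n) ℂ)
      ((mFourier fun i => (k i : ℤ)).toLp 2 (torusMeasure n) ℂ) =
      if (fun i => (m i : ℤ)) = (fun i => (k i : ℤ)) then (1 : ℂ) else 0 := ho
  rw [ContinuousMap.inner_toLp] at h
  simp only [monomial_torusPoint]
  simp only [natCast_comp_injective.eq_iff] at h
  rw [← h]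
  exact integral_congr_ae (.of_forall fun t => mul_comm _ _)

/-- Radially, the integrand converges almost everywhere and the factor `conj L * L = 1` cancels `θ`,
leaving the orthonormality of the monomials. -/
theorem IsInner.tendsto_integral {θ : (Fin n → ℂ) → ℂ} (hθ : IsInner θ) (m k : Fin n → ℕ) :
    Tendsto (fun r : ℝ => ∫ t, conj ((θ * monomial m) ((r : ℂ) • torusPoint t)) *
      (θ * monomial k) ((r : ℂ) • torusPoint t) ∂torusMeasure n) (𝓝[<] 1)
      (𝓝 (if m = k then 1 else 0)) := by
  obtain ⟨⟨hd, C, hC⟩, hL⟩ := hθ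
  rw [← integral_conj_monomial_mul]
  refine tendsto_integral_filter_of_dominated_convergence (fun _ => C * C) ?_ ?_
    (integrable_const _) ?_
  · filter_upwards [Ioo_mem_nhdsLT_one] with r hr
    have hs : Continuous fun t : UnitAddTorus (Fin n) => (r : ℂ) • torusPoint t :=
      (continuous_const_smul (r : ℂ)).comp continuous_torusPoint
    have hc : ∀ j : Fin n → ℕ, Continuous fun t : UnitAddTorus (Fin n) =>
        (θ * monomial j) ((r : ℂ) • torusPoint t) := fun j =>
      (hd.continuousOn.mul (continuous_monomial j).continuousOn).comp_continuous
        hs (smul_torusPoint_mem hr)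
    exact ((Complex.continuous_conj.comp (hc m)).mul (hc k)).aestronglyMeasurable
  · filter_upwards [Ioo_mem_nhdsLT_one] with r hr
    refine .of_forall fun t => ?_
    have hz := smul_torusPoint_mem hr t
    have hb : ∀ j : Fin n → ℕ, ‖(θ * monomial j) ((r : ℂ) • torusPoint t)‖ ≤ C := fun j => by
      rw [Pi.mul_apply, norm_mul]
      exact (mul_le_of_le_one_right (norm_nonneg _) (norm_monomial_le_one j hz)).trans (hC _ hz)
    rw [norm_mul, RCLike.norm_conj]
    exact mul_le_mul (hb m) (hb k) (norm_nonneg _) ((norm_nonneg _).trans (hb m))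
  · filter_upwards [hL] with t ⟨L, hL, hL1⟩
    have hmono : ∀ j, Tendsto (fun r : ℝ => monomial j ((r : ℂ) • torusPoint t)) (𝓝[<] 1)
        (𝓝 (monomial j (torusPoint t))) := fun j => by
      have hc : Continuous fun r : ℝ => monomial j ((r : ℂ) • torusPoint t) :=
        (continuous_monomial j).comp (Complex.continuous_ofReal.smul continuous_const)
      simpa using (hc.tendsto 1).mono_left (nhdsWithin_le_nhds (s := Set.Iio 1))
    have hLL : conj L * L = 1 := by
      rw [← Complex.normSq_eq_conj_mul_self, Complex.normSq_eq_norm_sq, hL1]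
      norm_num
    have h := ((Complex.continuous_conj.tendsto _).comp (hL.mul (hmono m))).mul
      (hL.mul (hmono k))
    have e : conj (L * monomial m (torusPoint t)) * (L * monomial k (torusPoint t)) =
        conj (monomial m (torusPoint t)) * monomial k (torusPoint t) := by
      rw [map_mul, mul_mul_mul_comm, hLL, one_mul]
    rw [e] at h
    exact h

/-- Multiplication by an inner function is an isometry of the Hardy space. -/
theorem IsInner.exists_isMulOperator {θ : (Fin n → ℂ) → ℂ} (hθ : IsInner θ) :
    ∃ M : HardySpace n →L[ℂ] HardySpace n, IsMulOperator θ M ∧ Isometry M := by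
  obtain ⟨hd, C, hC⟩ := hθ.1
  have hdm : ∀ m, DifferentiableOn ℂ (θ * monomial m) (polydisc n) := fun m =>
    hd.mul (differentiable_monomial m).differentiableOn
  have hrep : ∀ m, ∃ f : HardySpace n, Represents f (θ * monomial m) := fun m =>
    exists_represents (hdm m) (C := C) fun z hz => by
      rw [Pi.mul_apply, norm_mul]
      exact (mul_le_of_le_one_right (norm_nonneg _) (norm_monomial_le_one m hz)).trans (hC _ hz)
  choose e he using hrep
  have ho : Orthonormal ℂ e := orthonormal_iff_ite.2 fun m k =>
    tendsto_nhds_unique ((he m).tendsto_inner (he k) (hdm m) (hdm k)) (hθ.tendsto_integral m k)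
  let V : HardySpace n →ₗᵢ[ℂ] HardySpace n := ho.orthogonalFamily.linearIsometry
  refine ⟨V.toContinuousLinearMap, fun f z => ?_, V.isometry⟩
  have h1 : HasSum (fun m => f.coeff m • e m) (V f) := ho.orthogonalFamily.hasSum_linearIsometry f
  -- Point evaluation is continuous, so the series for `V f` may be evaluated at `z` term by term.
  have h2 := (innerSL ℂ (HardySpace.szegoVec z)).hasSum h1
  simp only [map_smul, innerSL_apply_apply, ← HardySpace.eval_eq_inner] at h2
  have h3 := (HardySpace.hasSum_apply f z).mul_left (θ z)
  refine HasSum.unique (h2 : HasSum _ (V f z)) (h3.congr_fun fun m => ?_)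
  have h4 : (e m).eval z = _ := (he m).apply_eq (hdm m) z
  rw [h4, Pi.mul_apply, smul_eq_mul]
  ring

/-! ### Szegő vectors, the adjoint and purity -/

theorem HardySpace.szegoVec_ne_zero (z : polydisc n) : szegoVec z ≠ 0 := fun h => by
  have h1 := szegoVec_coeff z 0
  rw [h] at h1
  have h2 : (0 : HardySpace n).coeff 0 = 0 := rfl
  simp [h2, monomial] at h1

/-- A vector orthogonal to every Szegő vector is a function vanishing on the polydisc, hence zero.
-/
theorem HardySpace.span_szegoVec_dense :
    (Submodule.span ℂ (Set.range (szegoVec (n := n)))).topologicalClosure = ⊤ := by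
  rw [Submodule.topologicalClosure_eq_top_iff, Submodule.eq_bot_iff]
  intro f hf
  refine lp.ext (funext fun m => coeff_eq_zero_of_eval_eq_zero f (fun z => ?_) m)
  rw [eval_eq_inner]
  exact hf _ (Submodule.subset_span ⟨z, rfl⟩)

theorem IsMulOperator.adjoint_szegoVec {θ : (Fin n → ℂ) → ℂ} {M : HardySpace n →L[ℂ] HardySpace n}
    (hM : IsMulOperator θ M) (z : polydisc n) :
    ContinuousLinearMap.adjoint M (HardySpace.szegoVec z) =
      conj (θ z) • HardySpace.szegoVec z := by
  refine ext_inner_right ℂ fun f => ?_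
  rw [ContinuousLinearMap.adjoint_inner_left, inner_smul_left, Complex.conj_conj,
    ← HardySpace.eval_eq_inner, ← HardySpace.eval_eq_inner]
  exact hM f z

theorem isOpen_polydisc : IsOpen (polydisc n) := by
  simp only [polydisc, Set.ofPred_forall]
  exact isOpen_iInter_of_finite fun i => isOpen_lt (continuous_apply i).norm continuous_const

theorem isPreconnected_polydisc : IsPreconnected (polydisc n) := by
  have h : polydisc n = Set.univ.pi fun _ => Metric.ball (0 : ℂ) 1 := by
    ext z
    simp [polydisc]
  rw [h]
  exact (convex_pi fun _ _ => convex_ball 0 1).isPreconnected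

/-- By the maximum principle, attaining modulus one inside the connected polydisc would force `θ` to
be constant. -/
theorem norm_lt_one_of_not_const {θ : (Fin n → ℂ) → ℂ} (hd : DifferentiableOn ℂ θ (polydisc n))
    (hle : ∀ z ∈ polydisc n, ‖θ z‖ ≤ 1) (hnc : ¬ ∃ c : ℂ, ∀ z ∈ polydisc n, θ z = c)
    {z : Fin n → ℂ} (hz : z ∈ polydisc n) : ‖θ z‖ < 1 := by
  refine (hle z hz).lt_of_ne fun h => hnc ⟨θ z, fun w hw => ?_⟩
  exact Complex.eqOn_of_isPreconnected_of_isMaxOn_norm isPreconnected_polydisc isOpen_polydisc hd hz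
    (fun y hy => by simpa [h] using hle y hy) hw

section Operators

variable {H : Type*} [NormedAddCommGroup H] [InnerProductSpace ℂ H]

/-- A contraction whose powers tend strongly to zero on eigenvectors spanning a dense subspace tends
strongly to zero. -/
theorem tendsto_pow_apply_of_dense {A : H →L[ℂ] H} (hA : ‖A‖ ≤ 1) {S : Set H}
    (hS : (Submodule.span ℂ S).topologicalClosure = ⊤)
    (h : ∀ v ∈ S, ∃ c : ℂ, ‖c‖ < 1 ∧ A v = c • v) (x : H) :
    Tendsto (fun m : ℕ => (A ^ m) x) atTop (𝓝 0) := by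
  have hspan : ∀ y ∈ Submodule.span ℂ S, Tendsto (fun m : ℕ => (A ^ m) y) atTop (𝓝 0) := by
    intro y hy
    induction hy using Submodule.span_induction with
    | mem v hv =>
      obtain ⟨c, hc, hAv⟩ := h v hv
      have e : ∀ m : ℕ, (A ^ m) v = c ^ m • v := fun m => by
        induction m with
        | zero => simp
        | succ m ih => rw [pow_succ, mul_apply_eq_comp, hAv, map_smul, ih, smul_smul,
            pow_succ']
      simp only [e]
      simpa using (tendsto_pow_atTop_nhds_zero_of_norm_lt_one hc).smul_const v
    | zero => simp
    | add y z _ _ hy hz => simpa using hy.add hz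
    | smul c y _ hy => simpa using hy.const_smul c
  have hpow : ∀ m : ℕ, ‖A ^ m‖ ≤ 1 := fun m => by
    induction m with
    | zero => exact ContinuousLinearMap.norm_id_le
    | succ m ih =>
      rw [pow_succ]
      exact (norm_mul_le _ _).trans (mul_le_one₀ ih (norm_nonneg _) hA)
  rw [Metric.tendsto_atTop]
  intro ε hε
  have hx : x ∈ closure (Submodule.span ℂ S : Set H) := by
    rw [← Submodule.topologicalClosure_coe, hS]
    trivial
  obtain ⟨y, hy, hxy⟩ := Metric.mem_closure_iff.1 hx (ε / 2) (half_pos hε)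
  obtain ⟨N, hN⟩ := Metric.tendsto_atTop.1 (hspan y hy) (ε / 2) (half_pos hε)
  refine ⟨N, fun m hm => ?_⟩
  -- All powers are contractions, so approximating `x` by `y` costs the same for every `m`.
  have h1 : dist ((A ^ m) x) ((A ^ m) y) ≤ dist x y := by
    rw [dist_eq_norm, dist_eq_norm, ← map_sub]
    exact (A ^ m).le_of_opNorm_le_of_le (hpow m) le_rfl |>.trans_eq (one_mul _)
  linarith [dist_triangle ((A ^ m) x) ((A ^ m) y) 0, hN m hm]

end Operators

end PolydiscHardy

end

theorem mainTheorem10 (n : ℕ) (θ : (Fin n → ℂ) → ℂ) (hθ : PolydiscHardy.IsInner θ)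
    (hnc : ¬ ∃ c : ℂ, ∀ z ∈ PolydiscHardy.polydisc n, θ z = c) :
    ∃ M : PolydiscHardy.HardySpace n →L[ℂ] PolydiscHardy.HardySpace n,
      PolydiscHardy.IsMulOperator θ M ∧ PolydiscHardy.IsPureIsometry M := by
  obtain ⟨M, hM, hiso⟩ := hθ.exists_isMulOperator
  have hM1 : ‖M‖ ≤ 1 := M.opNorm_le_bound zero_le_one fun f => by
    rw [one_mul, hiso.norm_map_of_map_zero (map_zero M)]
  have hA1 : ‖ContinuousLinearMap.adjoint M‖ ≤ 1 := by
    rwa [LinearIsometryEquiv.norm_map]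
  -- Eigenvalues of a contraction have modulus at most one, so the bound needs no Poisson integral.
  have hle : ∀ z ∈ PolydiscHardy.polydisc n, ‖θ z‖ ≤ 1 := fun z hz => by
    have h := (ContinuousLinearMap.adjoint M).le_of_opNorm_le hA1
      (PolydiscHardy.HardySpace.szegoVec ⟨z, hz⟩)
    rw [hM.adjoint_szegoVec, norm_smul, RCLike.norm_conj] at h
    exact le_of_mul_le_mul_right h
      (norm_pos_iff.2 (PolydiscHardy.HardySpace.szegoVec_ne_zero _))
  refine ⟨M, hM, hiso, hM1, fun f => ?_⟩
  refine tendsto_zero_iff_norm_tendsto_zero.1 (PolydiscHardy.tendsto_pow_apply_of_dense hA1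
    PolydiscHardy.HardySpace.span_szegoVec_dense ?_ f)
  rintro _ ⟨z, rfl⟩
  refine ⟨_, ?_, hM.adjoint_szegoVec z⟩
  rw [RCLike.norm_conj]
  exact PolydiscHardy.norm_lt_one_of_not_const hθ.1.1 hle hnc z.2
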